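/- Let $\mathcal H$ be a real Hilbert space and let $F_1,\dots,F_n\colon\mathcal H\rightrightarrows\mathcal H$ be maximally monotone set-valued operators such that $\operatorname{zer}\bigl(\sum_{i=1}^nF_i\bigr):=\{x\in\mathcal H: 0\in\sum_{i=1}^nF_i(x)\}\neq\emptyset$. Let $M\in\mathbb R^{m\times n}$, $S\in\mathbb R^{n\times m}$ and $N\in\mathbb R^{n\times n}$ satisfy (a) $\ker M\subseteq\mathbb R e$, where $e=(1,\dots,1)^T\in\mathbb R^n$; (b) $\sum_{i,j=1}^nN_{ij}=n$, and $N$ is lower triangular with zeros on the diagonal; (c) $S^*=-M$; (d) $M^*M+N+N^*-2\,\mathrm{Id}\preceq 0$. Let $\gamma\in(0,1)$. Write $\mathbf M=M\otimes\mathrm{Id}\colon\mathcal H^n\to\mathcal H^m$, that is, $(\mathbf M\mathbf x)_i=\sum_jM_{ij}x_j$, and similarly $\mathbf S\colon\mathcal H^m\to\mathcal H^n$ and $\mathbf N\colon\mathcal H^n\to\mathcal H^n$. Put $\mathbf F(\mathbf x)=F_1(x_1)\times\dots\times F_n(x_n)$ for $\mathbf x=(x_1,\dots,x_n)\in\mathcal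 H^n$, and let $J_{\mathbf F}=(\mathrm{Id}+\mathbf F)^{-1}$ be its resolvent. Then for every $\mathbf z\in\mathcal H^m$ there is exactly one $\mathbf x\in\mathcal H^n$ with $\mathbf x=J_{\mathbf F}(\mathbf S\mathbf z+\mathbf N\mathbf x)$, so that $$T(\mathbf z):=\mathbf z+\gamma\mathbf M\mathbf x,\qquad \mathbf x=J_{\mathbf F}(\mathbf S\mathbf z+\mathbf N\mathbf x),$$ is a well-defined operator $T\colon\mathcal H^m\to\mathcal H^m$. Moreover, for every $\mathbf z^0\in\mathcal H^m$, the sequences $(\mathbf z^k)$ in $\mathcal H^m$ and $(\mathbf x^k)$ in $\mathcal H^n$ given by $$\mathbf z^{k+1}=T(\mathbf z^k)=\mathbf z^k+\gamma\mathbf M\mathbf x^k,\qquad \mathbf x^k=J_{\mathbf F}(\mathbf S\mathbf z^k+\mathbf N\mathbf x^k)$$ satisfy the following. 1. As $k\to\infty$, $\mathbf z^k-\mathbf z^{k+1}\to0$, and $\sum_{i=1}^ns_ix_i^k\to0$ for all $s\in\mathbb R^n$ with $\sum_{i=1}^ns_i=0$ (strong convergence). 2. $(\mathbf z^k)$ converges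 weakly to a point $\bar{\mathbf z}\in\operatorname{Fix}T=\{\mathbf z:T(\mathbf z)=\mathbf z\}$. 3. $(\mathbf x^k)$ converges weakly to a point $(\bar x,\dots,\bar x)\in\mathcal H^n$ with $\bar x\in\operatorname{zer}\bigl(\sum_{i=1}^nF_i\bigr)$. -/

import Mathlib

open Filter Topology

namespace ResolventSplitting

/-- The Hilbert space `H^m`, i.e. the `ℓ²`-product of `m` copies of `H`. -/
abbrev HPow (H : Type*) (m : ℕ) : Type _ := PiLp 2 (fun _ : Fin m => H)

section Operators

variable {E : Type*} [NormedAddCommGroup E] [InnerProductSpace ℝ E]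

/-- A set-valued operator `A : E ⇉ E` (given by `x ↦ A x ⊆ E`) is monotone. -/
def IsMonotone (A : E → Set E) : Prop :=
  ∀ x x' y y' : E, y ∈ A x → y' ∈ A x' → 0 ≤ inner ℝ (x - x') (y - y')

/-- A set-valued operator is maximally monotone if it is monotone and its graph has no proper
monotone extension. -/
def IsMaximallyMonotone (A : E → Set E) : Prop :=
  IsMonotone A ∧ ∀ B : E → Set E, IsMonotone B → (∀ x, A x ⊆ B x) → ∀ x, B x ⊆ A x

/-- The set of zeros `{x | 0 ∈ A x}` of a set-valued operator. -/
def zer (A : E → Set E) : Set E := {x | 0 ∈ A x}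

/-- The resolvent `J_A = (Id + A)⁻¹` as a set-valued operator:
`x ∈ J_A y` iff `y ∈ x + A x`. -/
def resolvent (A : E → Set E) (y : E) : Set E := {x | ∃ v ∈ A x, y = x + v}

/-- The fixed points of a set-valued operator; for a single-valued one, `T z = {t z}`, these are
the `z` with `z = t z`. -/
def Fix (T : E → Set E) : Set E := {z | z ∈ T z}

/-- The pointwise (Minkowski) sum `x ↦ F₁ x + ⋯ + Fₙ x`. -/
def opSum {n : ℕ} (F : Fin n → E → Set E) (x : E) : Set E :=
  {v | ∃ u : Fin n → E, (∀ i, u i ∈ F i x) ∧ v = ∑ i, u i}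

/-- The product operator `(x₁, …, xₙ) ↦ F₁ x₁ × ⋯ × Fₙ xₙ` on `E^n`. -/
def opProd {n : ℕ} (F : Fin n → E → Set E) (x : HPow E n) : Set (HPow E n) :=
  {v | ∀ i, v i ∈ F i (x i)}

/-- The operator `A ⊗ Id : E^q → E^p` induced by a matrix `A ∈ ℝ^{p × q}`. -/
noncomputable def kron {p q : ℕ} (A : Matrix (Fin p) (Fin q) ℝ) (x : HPow E q) : HPow E p :=
  WithLp.toLp 2 (fun i => ∑ j, A i j • x j)

/-- Weak convergence of a sequence. -/
def WeakTendsto (u : ℕ → E) (a : E) : Prop :=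
  Tendsto (fun k => toWeakSpace ℝ E (u k)) atTop (𝓝 (toWeakSpace ℝ E a))

end Operators

/-- The standing assumptions on the coefficient matrices. -/
structure CoeffAssumption {m n : ℕ} (M : Matrix (Fin m) (Fin n) ℝ) (S : Matrix (Fin n) (Fin m) ℝ)
    (N : Matrix (Fin n) (Fin n) ℝ) : Prop where
  /-- `ker M ⊆ ℝ e`, where `e = (1, …, 1)`. -/
  ker_le : LinearMap.ker M.mulVecLin ≤ Submodule.span ℝ {(fun _ => 1 : Fin n → ℝ)}
  sum_eq : ∑ i, ∑ j, N i j = (n : ℝ)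
  /-- `N` is lower triangular with zeros on the diagonal. -/
  strictLower : ∀ i j, i ≤ j → N i j = 0
  adjoint_eq : S.transpose = -M
  /-- `M* M + N + N* - 2 Id ⪯ 0`. -/
  negSemidef : (-(M.transpose * M + N + N.transpose - (2 : ℝ) • 1)).PosSemidef

section Splitting

variable {H : Type*} [NormedAddCommGroup H] [InnerProductSpace ℝ H] {m n : ℕ}

/-- The solutions `x ∈ H^n` of `x = J_F (S z + N x)`, where `F = (F₁, …, Fₙ)`. -/
def innerSol (F : Fin n → H → Set H) (S : Matrix (Fin n) (Fin m) ℝ)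
    (N : Matrix (Fin n) (Fin n) ℝ) (z : HPow H m) : Set (HPow H n) :=
  {x | x ∈ resolvent (opProd F) (kron S z + kron N x)}

/-- The operator `T z = z + γ M x`, where `x = J_F (S z + N x)`. -/
def splitOp (F : Fin n → H → Set H) (M : Matrix (Fin m) (Fin n) ℝ) (S : Matrix (Fin n) (Fin m) ℝ)
    (N : Matrix (Fin n) (Fin n) ℝ) (γ : ℝ) (z : HPow H m) : Set (HPow H m) :=
  {w | ∃ x ∈ innerSol F S N z, w = z + γ • kron M x}

end Splitting

end ResolventSplitting

open ResolventSplitting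

/-!
The splitting operator is averaged, and its fixed points encode the zeros of `∑ i, F i`.

The resolvents are everywhere defined by Minty's theorem
(`IsMaximallyMonotone.exists_mem_resolvent`), which is proved by minimizing a strongly convex
function over the epigraph of the Fitzpatrick function. As `N` is strictly lower triangular, the
equation for `x` is solved by forward substitution (`exists_mem_innerSol`), and the solution depends
on `z` in a Lipschitz continuous way (`exists_norm_sub_le_of_mem_innerSol`).

If `x`, `x'` are the solutions for `z`, `z'`, monotonicity together with `S = -Mᵀ` and
`Mᵀ M + N + Nᵀ ≤ 2` gives `2 ⟪z - z', M (x - x')⟫ ≤ -‖M (x - x')‖²`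
(`two_mul_inner_le_of_mem_innerSol`). So the iteration is Fejér monotone with respect to the fixed
points and `M (x k) → 0` strongly (`norm_sq_add_smul_sub_le`). The kernel of `M` is the diagonal, so
that `x` minus its mean is a linear function of `M x`
(`CoeffAssumption.exists_kron_kron_eq_sub_mean`): this gives the strong convergence statements, and
the correspondence between fixed points and zeros (`exists_mem_innerSol_kron_eq_zero`,
`exists_mem_zer_of_kron_eq_zero`).

For weak convergence, `z k` and `x k` are bounded and have weak limits along every ultrafilter. A
demiclosedness argument for the pair (`mem_innerSol_of_tendsto_inner`) shows that the limits form a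
fixed point, and Opial's argument that they are the same for all ultrafilters.
-/

namespace ResolventSplitting

/-! ### Minty's theorem -/

section Minty

/-- The strongly convex function `(p, t) ↦ t + ‖p‖² / 2` attains its infimum on a nonempty closed
convex set on which it is bounded below; the conclusion is the first-order optimality condition
at a minimizer. -/
theorem exists_forall_add_sq_norm_le_add_inner {K : Type*} [NormedAddCommGroup K]
    [InnerProductSpace ℝ K] [CompleteSpace K] {C : Set (K × ℝ)} (hne : C.Nonempty)
    (hcl : IsClosed C) (hconv : Convex ℝ C) {b : ℝ}
    (hb : ∀ c ∈ C, b ≤ c.2 + ‖c.1‖ ^ 2 / 2) :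
    ∃ p ∈ C, ∀ q ∈ C, p.2 + ‖p.1‖ ^ 2 ≤ q.2 + inner ℝ p.1 q.1 := by
  set φ : K × ℝ → ℝ := fun c => c.2 + ‖c.1‖ ^ 2 / 2 with hφ
  have hbdd : BddBelow (φ '' C) := ⟨b, by rintro _ ⟨c, hc, rfl⟩; exact hb c hc⟩
  set μ := sInf (φ '' C) with hμ
  have hle : ∀ c ∈ C, μ ≤ φ c := fun c hc => csInf_le hbdd ⟨c, hc, rfl⟩
  have hseq : ∀ k : ℕ, ∃ c ∈ C, φ c < μ + 1 / ((k : ℝ) + 1) := by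
    intro k
    obtain ⟨_, ⟨c, hc, rfl⟩, h⟩ := exists_lt_of_csInf_lt (hne.image φ)
      (show sInf (φ '' C) < μ + 1 / ((k : ℝ) + 1) by
        have : 0 < 1 / ((k : ℝ) + 1) := by positivity
        linarith)
    exact ⟨c, hc, h⟩
  choose c hcC hc using hseq
  -- The parallelogram identity at the midpoint of two almost minimizers.
  have hpar : ∀ p ∈ C, ∀ q ∈ C, ‖p.1 - q.1‖ ^ 2 ≤ 4 * ((φ p - μ) + (φ q - μ)) := by
    intro p hp q hq
    have hmid := hle _ (hconv hp hq (by norm_num : (0 : ℝ) ≤ 1 / 2) (by norm_num : (0 : ℝ) ≤ 1 / 2)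
      (by norm_num))
    have e : ‖(1 / 2 : ℝ) • p.1 + (1 / 2 : ℝ) • q.1‖ ^ 2 = ‖p.1 + q.1‖ ^ 2 / 4 := by
      rw [← smul_add, norm_smul, mul_pow]; norm_num; ring
    have e2 := parallelogram_law_with_norm ℝ p.1 q.1
    simp only [hφ, Prod.fst_add, Prod.snd_add, Prod.smul_fst, Prod.smul_snd, smul_eq_mul] at hmid ⊢
    rw [e] at hmid
    nlinarith
  have hdist : ∀ k l N : ℕ, N ≤ k → N ≤ l →
      dist (c k).1 (c l).1 ≤ Real.sqrt (8 * (1 / ((N : ℝ) + 1))) := by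
    intro k l N hk hl
    rw [dist_eq_norm]
    refine Real.le_sqrt_of_sq_le ((hpar _ (hcC k) _ (hcC l)).trans ?_)
    have h1 := (hc k).le.trans (add_le_add_right (Nat.one_div_le_one_div (α := ℝ) hk) μ)
    have h2 := (hc l).le.trans (add_le_add_right (Nat.one_div_le_one_div (α := ℝ) hl) μ)
    linarith
  have hlim0 : Tendsto (fun N : ℕ => 1 / ((N : ℝ) + 1)) atTop (𝓝 0) :=
    tendsto_one_div_add_atTop_nhds_zero_nat
  have hcau : CauchySeq fun k => (c k).1 := by
    refine cauchySeq_of_le_tendsto_0 _ hdist ?_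
    simpa only [mul_zero, Real.sqrt_zero, Function.comp_def] using
      (Real.continuous_sqrt.tendsto _).comp (hlim0.const_mul 8)
  obtain ⟨p, hp⟩ := cauchySeq_tendsto_of_complete hcau
  have hφlim : Tendsto (fun k => φ (c k)) atTop (𝓝 μ) := by
    refine tendsto_of_tendsto_of_tendsto_of_le_of_le tendsto_const_nhds ?_
      (fun k => hle _ (hcC k)) (fun k => (hc k).le)
    simpa using hlim0.const_add μ
  have ht : Tendsto (fun k => (c k).2) atTop (𝓝 (μ - ‖p‖ ^ 2 / 2)) := by
    have := hφlim.sub ((hp.norm.pow 2).div_const 2)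
    refine this.congr fun k => ?_
    simp [hφ]
  have hmem : (p, μ - ‖p‖ ^ 2 / 2) ∈ C :=
    hcl.mem_of_tendsto (hp.prodMk_nhds ht) (Eventually.of_forall hcC)
  refine ⟨_, hmem, fun q hq => ?_⟩
  set t := μ - ‖p‖ ^ 2 / 2 with htdef
  -- Compare with the points `p + r • (q - p)` of the segment and let `r → 0`.
  have key : ∀ r ∈ Set.Ioo (0 : ℝ) 1,
      0 ≤ (q.2 - t) + inner ℝ p (q.1 - p) + r * (‖q.1 - p‖ ^ 2 / 2) := by
    intro r hr
    have h := hle _ (hconv hmem hq (by linarith [hr.2] : (0 : ℝ) ≤ 1 - r) hr.1.le (by ring))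
    have e : (1 - r) • p + r • q.1 = p + r • (q.1 - p) := by module
    simp only [hφ, Prod.fst_add, Prod.snd_add, Prod.smul_fst, Prod.smul_snd, smul_eq_mul] at h
    rw [e, norm_add_sq_real, norm_smul, real_inner_smul_right, Real.norm_of_nonneg hr.1.le] at h
    have hμt : μ = t + ‖p‖ ^ 2 / 2 := by rw [htdef]; ring
    rw [hμt] at h
    have h' : 0 ≤ r * ((q.2 - t) + inner ℝ p (q.1 - p) + r * (‖q.1 - p‖ ^ 2 / 2)) := by nlinarith
    exact nonneg_of_mul_nonneg_right h' hr.1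
  have hfin : 0 ≤ (q.2 - t) + inner ℝ p (q.1 - p) := by
    have hT : Tendsto (fun r : ℝ => (q.2 - t) + inner ℝ p (q.1 - p) + r * (‖q.1 - p‖ ^ 2 / 2))
        (𝓝[>] 0) (𝓝 ((q.2 - t) + inner ℝ p (q.1 - p) + 0 * (‖q.1 - p‖ ^ 2 / 2))) :=
      (Continuous.tendsto (by fun_prop) 0).mono_left nhdsWithin_le_nhds
    have := ge_of_tendsto hT (by
      filter_upwards [Ioo_mem_nhdsGT (zero_lt_one (α := ℝ))] with r hr using key r hr)
    simpa using this
  rw [inner_sub_right, real_inner_self_eq_norm_sq] at hfin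
  simp only
  linarith

variable {H : Type*} [NormedAddCommGroup H] [InnerProductSpace ℝ H]

/-- A point that is monotonically related to the graph of a maximally monotone operator belongs to
that graph. -/
theorem IsMaximallyMonotone.mem_of_forall_inner_nonneg {A : H → Set H}
    (hA : IsMaximallyMonotone A) {x u : H}
    (h : ∀ a b, b ∈ A a → 0 ≤ inner ℝ (x - a) (u - b)) : u ∈ A x := by
  refine hA.2 (fun y => A y ∪ {v | y = x ∧ v = u}) ?_ (fun y => Set.subset_union_left) x
    (Or.inr ⟨rfl, rfl⟩)
  rintro a a' b b' (hb | ⟨rfl, rfl⟩) (hb' | ⟨rfl, rfl⟩)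
  · exact hA.1 _ _ _ _ hb hb'
  · have := h _ _ hb
    rwa [← neg_sub a, ← neg_sub b, inner_neg_neg] at this
  · exact h _ _ hb'
  · simp

/-- Minty's theorem at the origin. Let `C` be the epigraph of the Fitzpatrick function
`(x, u) ↦ ⨆ {⟪x, b⟫ + ⟪a, u⟫ - ⟪a, b⟫ | b ∈ A a}`, which dominates `⟪x, u⟫`. The optimality condition
at the minimizer `(x₀, u₀)` of `t + ‖(x, u)‖² / 2` over `C` yields
`⟪a + u₀, b + x₀⟫ ≥ ‖x₀ + u₀‖²` on the graph of `A`. Hence `(-u₀, -x₀)` is in the graph, and then `x₀ = -u₀`. -/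
theorem IsMaximallyMonotone.exists_neg_mem [CompleteSpace H] {A : H → Set H}
    (hA : IsMaximallyMonotone A) : ∃ x, -x ∈ A x := by
  set C : Set (WithLp 2 (H × H) × ℝ) := {c | ∀ a b, b ∈ A a →
    inner ℝ c.1.fst b + inner ℝ a c.1.snd - inner ℝ a b ≤ c.2} with hC
  have hdom : ∀ c ∈ C, inner ℝ c.1.fst c.1.snd ≤ c.2 := by
    intro c hc
    by_contra! hlt
    have hmem : c.1.snd ∈ A c.1.fst := by
      refine hA.mem_of_forall_inner_nonneg fun a b hab => ?_
      have := hc a b hab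
      simp only [inner_sub_left, inner_sub_right]
      linarith
    have := hc _ _ hmem
    linarith
  have hgraph : ∀ a b, b ∈ A a →
      ((WithLp.toLp 2 (a, b), inner ℝ a b) : WithLp 2 (H × H) × ℝ) ∈ C := by
    intro a b hab a' b' hab'
    have := hA.1 _ _ _ _ hab hab'
    simp only [inner_sub_left, inner_sub_right, WithLp.toLp_fst, WithLp.toLp_snd] at this ⊢
    linarith
  have hne : C.Nonempty := by
    by_cases h : ∃ a b, b ∈ A a
    · obtain ⟨a, b, hab⟩ := h
      exact ⟨_, hgraph a b hab⟩
    · push Not at h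
      exact absurd (hA.mem_of_forall_inner_nonneg (x := 0) (u := 0)
        fun a b hab => absurd hab (h a b)) (h 0 0)
  have hcl : IsClosed C := by
    simp only [hC, Set.ofPred_forall]
    refine isClosed_iInter fun a => isClosed_iInter fun b => isClosed_iInter fun _ => ?_
    refine isClosed_le ?_ (by fun_prop)
    have h1 : Continuous fun c : WithLp 2 (H × H) × ℝ => c.1.fst :=
      (WithLp.prod_continuous_ofLp 2 H H).fst.comp continuous_fst
    have h2 : Continuous fun c : WithLp 2 (H × H) × ℝ => c.1.snd :=
      (WithLp.prod_continuous_ofLp 2 H H).snd.comp continuous_fst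
    fun_prop
  have hconv : Convex ℝ C := by
    intro c hc d hd r s hr hs hrs a b hab
    have h1 := mul_le_mul_of_nonneg_left (hc a b hab) hr
    have h2 := mul_le_mul_of_nonneg_left (hd a b hab) hs
    simp only [Prod.fst_add, Prod.snd_add, Prod.smul_fst, Prod.smul_snd, smul_eq_mul,
      WithLp.add_fst, WithLp.add_snd, WithLp.smul_fst, WithLp.smul_snd, inner_add_left,
      inner_add_right, real_inner_smul_left, real_inner_smul_right]
    have e : inner ℝ a b = r * inner ℝ a b + s * inner ℝ a b := by rw [← add_mul, hrs, one_mul]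
    linarith
  have hnorm : ∀ w : WithLp 2 (H × H), ‖w‖ ^ 2 = ‖w.fst‖ ^ 2 + ‖w.snd‖ ^ 2 := fun w => by
    rw [← real_inner_self_eq_norm_sq, WithLp.prod_inner_apply]
    simp only [real_inner_self_eq_norm_sq]
    rfl
  have hbd : ∀ c ∈ C, (0 : ℝ) ≤ c.2 + ‖c.1‖ ^ 2 / 2 := by
    intro c hc
    have h1 := hdom c hc
    have h2 := norm_add_sq_real c.1.fst c.1.snd
    rw [hnorm]
    nlinarith [sq_nonneg ‖c.1.fst + c.1.snd‖]
  obtain ⟨p, hpC, hp⟩ := exists_forall_add_sq_norm_le_add_inner hne hcl hconv hbd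
  set x := p.1.fst with hx
  set u := p.1.snd with hu
  have hopt : ∀ a b, b ∈ A a → ‖x + u‖ ^ 2 ≤ inner ℝ (-u - a) (-x - b) := by
    intro a b hab
    have h := hp _ (hgraph a b hab)
    rw [WithLp.prod_inner_apply, hnorm] at h
    have h1 := hdom p hpC
    change p.2 + (‖x‖ ^ 2 + ‖u‖ ^ 2) ≤ inner ℝ a b + (inner ℝ x a + inner ℝ u b) at h
    rw [norm_add_sq_real]
    simp only [inner_sub_left, inner_sub_right, inner_neg_left, inner_neg_right]
    rw [real_inner_comm x u, real_inner_comm x a]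
    rw [real_inner_comm a x] at h
    rw [real_inner_comm] at h1
    nlinarith [real_inner_comm x a, real_inner_comm u x]
  have hmem : -x ∈ A (-u) :=
    hA.mem_of_forall_inner_nonneg fun a b hab => (sq_nonneg _).trans (hopt a b hab)
  have h0 := hopt _ _ hmem
  simp only [sub_self, inner_zero_left] at h0
  have h1 : x + u = 0 := by
    rw [← norm_eq_zero]
    exact pow_eq_zero_iff (two_ne_zero) |>.1 (le_antisymm h0 (sq_nonneg _))
  refine ⟨x, ?_⟩
  rwa [← eq_neg_of_add_eq_zero_left h1] at hmem

/-- **Minty's theorem**: the resolvent of a maximally monotone operator on a Hilbert space is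
everywhere defined. -/
theorem IsMaximallyMonotone.exists_mem_resolvent [CompleteSpace H] {A : H → Set H}
    (hA : IsMaximallyMonotone A) (y : H) : ∃ x, x ∈ resolvent A y := by
  have hB : IsMaximallyMonotone fun x => {v | v + y ∈ A x} := by
    refine ⟨fun x x' v v' h h' => ?_, fun B hB hAB x v hv => ?_⟩
    · have := hA.1 _ _ _ _ h h'
      rwa [add_sub_add_right_eq_sub] at this
    · refine hA.mem_of_forall_inner_nonneg fun a b hab => ?_
      have := hB x a v (b - y) hv (hAB a (by simpa using hab))
      rwa [show v - (b - y) = v + y - b by abel] at this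
  obtain ⟨x, hx⟩ := hB.exists_neg_mem
  exact ⟨x, _, hx, by abel⟩

/-- The resolvent of a monotone operator is nonexpansive. -/
theorem IsMonotone.norm_sub_le_of_mem_resolvent {A : H → Set H} (hA : IsMonotone A) {x x' y y' : H}
    (hx : x ∈ resolvent A y) (hx' : x' ∈ resolvent A y') : ‖x - x'‖ ≤ ‖y - y'‖ := by
  obtain ⟨v, hv, rfl⟩ := hx
  obtain ⟨v', hv', rfl⟩ := hx'
  have h := hA _ _ _ _ hv hv'
  have h1 : ‖x - x'‖ * ‖x - x'‖ ≤ ‖x - x'‖ * ‖x + v - (x' + v')‖ := by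
    refine le_trans ?_ (real_inner_le_norm _ _)
    rw [add_sub_add_comm, inner_add_right, real_inner_self_eq_norm_mul_norm]
    linarith
  rcases (norm_nonneg (x - x')).eq_or_lt with h0 | h0
  · rw [← h0]; exact norm_nonneg _
  · exact le_of_mul_le_mul_left h1 h0

/-- Componentwise use of Minty's theorem: a point monotonically related to the graph of a product of
maximally monotone operators belongs to that graph. -/
theorem mem_opProd_of_forall_inner_nonneg [CompleteSpace H] {n : ℕ} {F : Fin n → H → Set H}
    (hF : ∀ i, IsMaximallyMonotone (F i)) {x u : HPow H n}
    (h : ∀ a b, b ∈ opProd F a → 0 ≤ inner ℝ (x - a) (u - b)) : u ∈ opProd F x := by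
  choose a v hv e using fun i => (hF i).exists_mem_resolvent (x i + u i)
  have h1 := h (WithLp.toLp 2 a) (WithLp.toLp 2 v) hv
  have h2 : u - WithLp.toLp 2 v = -(x - WithLp.toLp 2 a) := by
    ext i
    have := e i
    simp only [PiLp.sub_apply, PiLp.neg_apply]
    rw [eq_sub_of_add_eq' this.symm]; abel
  rw [h2, inner_neg_right, real_inner_self_eq_norm_sq] at h1
  have h3 : x - WithLp.toLp 2 a = 0 := by
    rw [← norm_eq_zero]
    exact pow_eq_zero_iff (two_ne_zero) |>.1 (le_antisymm (by linarith) (sq_nonneg _))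
  rw [h3, neg_zero] at h2
  rw [sub_eq_zero.1 h2, sub_eq_zero.1 h3]
  exact hv

end Minty

/-! ### Weak convergence -/

section Weak

variable {E : Type*} [NormedAddCommGroup E] [InnerProductSpace ℝ E] [CompleteSpace E]

theorem weakTendsto_iff_forall_inner {u : ℕ → E} {a : E} :
    WeakTendsto u a ↔ ∀ w, Tendsto (fun k => inner ℝ w (u k)) atTop (𝓝 (inner ℝ w a)) := by
  refine (WeakBilin.tendsto_iff_forall_eval_tendsto (topDualPairing ℝ E).flip
    (fun x y h => ext_inner_left ℝ fun w => by
      simpa using LinearMap.congr_fun h (InnerProductSpace.toDual ℝ E w))).trans ?_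
  constructor
  · intro h w
    exact h (InnerProductSpace.toDual ℝ E w)
  · intro h f
    have := h ((InnerProductSpace.toDual ℝ E).symm f)
    simp only [InnerProductSpace.toDual_symm_apply] at this
    exact this

/-- Weak compactness of bounded sets in a Hilbert space, in terms of ultrafilters: the pointwise
limit of `w ↦ ⟪u k, w⟫` is a bounded linear functional, hence an inner product. -/
theorem exists_forall_tendsto_inner_of_norm_le {ι : Type*} (U : Ultrafilter ι) {u : ι → E} {R : ℝ}
    (hu : ∀ k, ‖u k‖ ≤ R) :
    ∃ a, ∀ w, Tendsto (fun k => inner ℝ w (u k)) U (𝓝 (inner ℝ w a)) := by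
  have hex : ∀ w, ∃ l, |l| ≤ R * ‖w‖ ∧ Tendsto (fun k => inner ℝ w (u k)) U (𝓝 l) := by
    intro w
    have hmem : ∀ k, inner ℝ w (u k) ∈ Set.Icc (-(R * ‖w‖)) (R * ‖w‖) := fun k =>
      abs_le.1 ((abs_real_inner_le_norm _ _).trans
        (by rw [mul_comm]; exact mul_le_mul_of_nonneg_right (hu k) (norm_nonneg _)))
    obtain ⟨l, hl, hlim⟩ := isCompact_Icc.ultrafilter_le_nhds (U.map fun k => inner ℝ w (u k))
      (le_principal_iff.2 (eventually_map.2 (Eventually.of_forall hmem)))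
    exact ⟨l, abs_le.2 hl, hlim⟩
  choose l hl hlim using hex
  let f : E →ₗ[ℝ] ℝ :=
    { toFun := l
      map_add' := fun w w' => tendsto_nhds_unique (hlim _)
        (((hlim w).add (hlim w')).congr fun k => (inner_add_left _ _ _).symm)
      map_smul' := fun r w => tendsto_nhds_unique (hlim _)
        (((hlim w).const_mul r).congr fun k => (real_inner_smul_left _ _ _).symm) }
  let g : StrongDual ℝ E := f.mkContinuous R hl
  refine ⟨(InnerProductSpace.toDual ℝ E).symm g, fun w => ?_⟩
  rw [real_inner_comm, InnerProductSpace.toDual_symm_apply]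
  exact hlim w

end Weak

/-! ### Matrices acting on powers of a Hilbert space -/

section Kron

variable {H : Type*} [NormedAddCommGroup H] [InnerProductSpace ℝ H] {m n p q : ℕ}

theorem kron_apply (A : Matrix (Fin p) (Fin q) ℝ) (x : HPow H q) (i : Fin p) :
    kron A x i = ∑ j, A i j • x j := rfl

theorem kron_sub (A : Matrix (Fin p) (Fin q) ℝ) (x y : HPow H q) :
    kron A (x - y) = kron A x - kron A y := by
  ext i; simp [kron_apply, smul_sub]

theorem add_kron (A B : Matrix (Fin p) (Fin q) ℝ) (x : HPow H q) :
    kron (A + B) x = kron A x + kron B x := by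
  ext i; simp [kron_apply, add_smul, Finset.sum_add_distrib]

theorem neg_kron (A : Matrix (Fin p) (Fin q) ℝ) (x : HPow H q) :
    kron (-A) x = -kron A x := by
  ext i; simp [kron_apply]

theorem smul_kron (r : ℝ) (A : Matrix (Fin p) (Fin q) ℝ) (x : HPow H q) :
    kron (r • A) x = r • kron A x := by
  ext i; simp [kron_apply, smul_smul, Finset.smul_sum]

theorem one_kron (x : HPow H q) : kron (1 : Matrix (Fin q) (Fin q) ℝ) x = x := by
  ext i; simp [kron_apply, Matrix.one_apply]

theorem kron_kron (A : Matrix (Fin p) (Fin q) ℝ) (B : Matrix (Fin q) (Fin n) ℝ) (x : HPow H n) :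
    kron A (kron B x) = kron (A * B) x := by
  ext i
  simp only [kron_apply, Matrix.mul_apply, Finset.smul_sum, Finset.sum_smul, smul_smul]
  rw [Finset.sum_comm]

theorem inner_kron_right (A : Matrix (Fin p) (Fin q) ℝ) (x : HPow H p) (y : HPow H q) :
    inner ℝ x (kron A y) = inner ℝ (kron A.transpose x) y := by
  simp only [PiLp.inner_apply, kron_apply, inner_sum, sum_inner, real_inner_smul_left,
    real_inner_smul_right, Matrix.transpose_apply]
  rw [Finset.sum_comm]

/-- A positive semidefinite matrix induces a positive semidefinite operator on `H ^ q`. -/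
theorem inner_kron_self_nonneg {A : Matrix (Fin q) (Fin q) ℝ} (hA : A.PosSemidef) (x : HPow H q) :
    0 ≤ inner ℝ x (kron A x) := by
  obtain ⟨r, v, rfl⟩ := Matrix.posSemidef_iff_eq_sum_vecMulVec.1 hA
  have e : inner ℝ x (kron (∑ k, Matrix.vecMulVec (v k) (star (v k))) x) =
      ∑ k, ‖∑ i, v k i • x i‖ ^ 2 := by
    simp only [← real_inner_self_eq_norm_sq, PiLp.inner_apply, kron_apply, inner_sum, sum_inner,
      real_inner_smul_left, real_inner_smul_right, Matrix.sum_apply, Matrix.vecMulVec_apply,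
      star_trivial, Finset.sum_mul]
    rw [Finset.sum_congr rfl fun i _ => Finset.sum_comm, Finset.sum_comm]
    refine Finset.sum_congr rfl fun k _ => ?_
    rw [Finset.sum_comm]
    exact Finset.sum_congr rfl fun i _ => Finset.sum_congr rfl fun j _ => by ring
  rw [e]
  positivity

theorem inner_toLp_const_left (h : H) (x : HPow H n) :
    inner ℝ (WithLp.toLp 2 fun _ => h : HPow H n) x = inner ℝ h (∑ i, x i) := by
  simp [PiLp.inner_apply, inner_sum]

/-- A matrix whose kernel is contained in the diagonal has a left inverse modulo the diagonal: some
`W` with `W * M = 1 - n⁻¹ e eᵀ`. -/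
theorem exists_mul_eq_one_sub_of_ker_le {M : Matrix (Fin m) (Fin n) ℝ}
    (hM : LinearMap.ker M.mulVecLin ≤ Submodule.span ℝ {(fun _ => 1 : Fin n → ℝ)}) :
    ∃ W : Matrix (Fin n) (Fin m) ℝ, W * M = 1 - Matrix.of fun _ _ => (n : ℝ)⁻¹ := by
  -- `W = P g`, where `P` removes the mean and `g` is a generalized inverse of `M`: the image of
  -- `g M - 1` lies in `ker M`, which `P` annihilates.
  set P : Matrix (Fin n) (Fin n) ℝ := 1 - Matrix.of fun _ _ => (n : ℝ)⁻¹ with hP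
  obtain ⟨g₀, hg₀⟩ := M.mulVecLin.rangeRestrict.exists_rightInverse_of_surjective
    M.mulVecLin.range_rangeRestrict
  obtain ⟨g, hg⟩ := g₀.exists_extend
  have hMg : ∀ v, M.mulVec (g (M.mulVec v)) = M.mulVec v := by
    intro v
    have h1 : g (M.mulVec v) = g₀ (M.mulVecLin.rangeRestrict v) :=
      LinearMap.congr_fun hg (M.mulVecLin.rangeRestrict v)
    have h2 := LinearMap.congr_fun hg₀ (M.mulVecLin.rangeRestrict v)
    rw [h1]
    exact congrArg Subtype.val h2
  have hPe : P.mulVec (fun _ => 1) = 0 := by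
    ext i
    have hn : (n : ℝ) ≠ 0 := Nat.cast_ne_zero.2 (Fin.pos i).ne'
    simp [hP, Matrix.mulVec, dotProduct, Matrix.one_apply, hn]
  refine ⟨P * LinearMap.toMatrix' g, Matrix.ext_of_mulVec_single fun i => ?_⟩
  set v : Fin n → ℝ := Pi.single i 1
  have hker : g (M.mulVec v) - v ∈ LinearMap.ker M.mulVecLin := by
    simp [Matrix.mulVec_sub, hMg]
  obtain ⟨c, hc⟩ := Submodule.mem_span_singleton.1 (hM hker)
  have : P.mulVec (g (M.mulVec v) - v) = 0 := by
    rw [← hc, Matrix.mulVec_smul, hPe, smul_zero]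
  rw [Matrix.mulVec_sub, sub_eq_zero] at this
  rw [← Matrix.mulVec_mulVec, ← Matrix.mulVec_mulVec, LinearMap.toMatrix'_mulVec, this]

namespace CoeffAssumption

variable {M : Matrix (Fin m) (Fin n) ℝ} {S : Matrix (Fin n) (Fin m) ℝ}
  {N : Matrix (Fin n) (Fin n) ℝ}

/-- The semidefiniteness assumption, as an inequality of quadratic forms on `H ^ n`. -/
theorem norm_sq_kron_le (h : CoeffAssumption M S N) (x : HPow H n) :
    ‖kron M x‖ ^ 2 ≤ 2 * (‖x‖ ^ 2 - inner ℝ x (kron N x)) := by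
  have h1 := inner_kron_self_nonneg h.negSemidef x
  rw [sub_eq_add_neg, neg_kron, add_kron, add_kron, add_kron, neg_kron, smul_kron, one_kron,
    ← kron_kron, inner_neg_right, inner_add_right, inner_add_right, inner_add_right,
    inner_neg_right, real_inner_smul_right, inner_kron_right M.transpose,
    inner_kron_right N.transpose, Matrix.transpose_transpose, Matrix.transpose_transpose,
    real_inner_self_eq_norm_sq, real_inner_self_eq_norm_sq, real_inner_comm x] at h1
  linarith

theorem sum_kron_const (h : CoeffAssumption M S N) (c : H) :
    ∑ i, kron N (WithLp.toLp 2 fun _ => c : HPow H n) i = (n : ℝ) • c := by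
  simp only [kron_apply, ← Finset.sum_smul]
  rw [h.sum_eq]

/-- The quadratic inequality `norm_sq_kron_le` has right-hand side zero on the diagonal, because the
entries of `N` sum to `n`; so `M` vanishes there. -/
theorem kron_const (h : CoeffAssumption M S N) (c : H) :
    kron M (WithLp.toLp 2 fun _ => c : HPow H n) = 0 := by
  have h1 := h.norm_sq_kron_le (WithLp.toLp 2 fun _ => c : HPow H n)
  have h2 : ∑ _i : Fin n, c = (n : ℝ) • c := by simp [Nat.cast_smul_eq_nsmul]
  rw [← real_inner_self_eq_norm_sq (WithLp.toLp 2 fun _ => c : HPow H n), inner_toLp_const_left,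
    inner_toLp_const_left, h.sum_kron_const, h2, sub_self, mul_zero] at h1
  rw [← norm_eq_zero]
  exact (pow_eq_zero_iff two_ne_zero).1 (le_antisymm h1 (sq_nonneg _))

theorem inner_kron_eq_neg (h : CoeffAssumption M S N) (x : HPow H n) (z : HPow H m) :
    inner ℝ x (kron S z) = -inner ℝ (kron M x) z := by
  rw [inner_kron_right, h.adjoint_eq, neg_kron, inner_neg_left]

theorem sum_kron_eq_zero (h : CoeffAssumption M S N) (z : HPow H m) :
    ∑ i, kron S z i = 0 := by
  refine ext_inner_left ℝ fun c => ?_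
  rw [← inner_toLp_const_left, h.inner_kron_eq_neg, h.kron_const, inner_zero_left, inner_zero_right,
    neg_zero]

/-- The deviation of `x` from its mean is a fixed linear function of `M x`. -/
theorem exists_kron_kron_eq_sub_mean (h : CoeffAssumption M S N) :
    ∃ W : Matrix (Fin n) (Fin m) ℝ, ∀ (x : HPow H n) (i : Fin n),
      kron W (kron M x) i = x i - (n : ℝ)⁻¹ • ∑ j, x j := by
  obtain ⟨W, hW⟩ := exists_mul_eq_one_sub_of_ker_le h.ker_le
  refine ⟨W, fun x i => ?_⟩
  rw [kron_kron, hW, sub_eq_add_neg, add_kron, one_kron, neg_kron]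
  simp [kron_apply, Finset.smul_sum, sub_eq_add_neg]

theorem exists_eq_const_of_kron_eq_zero (h : CoeffAssumption M S N) {x : HPow H n}
    (hx : kron M x = 0) : ∃ c, x = WithLp.toLp 2 fun _ => c := by
  obtain ⟨W, hW⟩ := h.exists_kron_kron_eq_sub_mean (H := H)
  refine ⟨(n : ℝ)⁻¹ • ∑ j, x j, ?_⟩
  ext i
  have := hW x i
  rw [hx] at this
  exact (sub_eq_zero.1 (this.symm.trans (by simp [kron_apply])))

theorem exists_kron_eq_of_sum_eq_zero (h : CoeffAssumption M S N) {r : HPow H n}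
    (hr : ∑ i, r i = 0) : ∃ z : HPow H m, kron S z = r := by
  obtain ⟨W, hW⟩ := exists_mul_eq_one_sub_of_ker_le h.ker_le
  -- `S (-Wᵀ) = (W M)ᵀ` is the projection onto the vectors with zero mean.
  have hS : S = -M.transpose := by rw [← Matrix.transpose_transpose S, h.adjoint_eq]; simp
  refine ⟨kron (-W.transpose) r, ?_⟩
  rw [kron_kron, hS, Matrix.neg_mul, Matrix.mul_neg, neg_neg, ← Matrix.transpose_mul, hW,
    Matrix.transpose_sub, sub_eq_add_neg, add_kron, neg_kron, Matrix.transpose_one, one_kron]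
  ext i
  simp [kron_apply, ← Finset.smul_sum, hr]

end CoeffAssumption

end Kron

/-! ### The inner problem -/

section Inner

variable {H : Type*} [NormedAddCommGroup H] [InnerProductSpace ℝ H] {m n : ℕ}
  {F : Fin n → H → Set H} {M : Matrix (Fin m) (Fin n) ℝ} {S : Matrix (Fin n) (Fin m) ℝ}
  {N : Matrix (Fin n) (Fin n) ℝ}

theorem mem_innerSol_iff {z : HPow H m} {x : HPow H n} :
    x ∈ innerSol F S N z ↔ kron S z + kron N x - x ∈ opProd F x := by
  constructor
  · rintro ⟨v, hv, e⟩
    rwa [e, add_sub_cancel_left]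
  · intro h
    exact ⟨_, h, by abel⟩

theorem mem_innerSol_iff_forall {z : HPow H m} {x : HPow H n} :
    x ∈ innerSol F S N z ↔ ∀ i, x i ∈ resolvent (F i) (kron S z i + kron N x i) := by
  rw [mem_innerSol_iff]
  refine forall_congr' fun i => ⟨fun h => ⟨_, h, by simp⟩, ?_⟩
  rintro ⟨v, hv, e⟩
  simpa [e] using hv

theorem inner_opProd_nonneg (hF : ∀ i, IsMonotone (F i)) {x x' v v' : HPow H n}
    (hv : v ∈ opProd F x) (hv' : v' ∈ opProd F x') : 0 ≤ inner ℝ (x - x') (v - v') := by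
  rw [PiLp.inner_apply]
  exact Finset.sum_nonneg fun i _ => hF i _ _ _ _ (hv i) (hv' i)

/-- Since `N` is strictly lower triangular, the components of a solution of the inner problem
can be computed one after the other, each by one resolvent evaluation. -/
theorem exists_mem_innerSol [CompleteSpace H] (hF : ∀ i, IsMaximallyMonotone (F i))
    (hN : ∀ i j, i ≤ j → N i j = 0) (z : HPow H m) : ∃ x, x ∈ innerSol F S N z := by
  choose J hJ using fun i => (hF i).exists_mem_resolvent
  have step : ∀ k ≤ n, ∃ x : HPow H n, ∀ i : Fin n, (i : ℕ) < k →
      x i = J i (kron S z i + kron N x i) := by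
    intro k
    induction k with
    | zero => exact fun _ => ⟨0, fun i hi => absurd hi (Nat.not_lt_zero _)⟩
    | succ k ih =>
      intro hk
      obtain ⟨x, hx⟩ := ih (Nat.le_of_succ_le hk)
      let a : Fin n := ⟨k, hk⟩
      let x' : HPow H n := WithLp.toLp 2 (Function.update x a (J a (kron S z a + kron N x a)))
      have hne : ∀ j, j ≠ a → x' j = x j := fun j hj => Function.update_of_ne hj _ _
      have hN' : ∀ i : Fin n, i ≤ a → kron N x' i = kron N x i := by
        intro i hi
        rw [kron_apply, kron_apply]
        refine Finset.sum_congr rfl fun j _ => ?_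
        rcases eq_or_ne j a with rfl | hj
        · rw [hN i _ hi, zero_smul, zero_smul]
        · rw [hne j hj]
      refine ⟨x', fun i hi => ?_⟩
      rw [hN' i (Fin.le_def.2 (Nat.lt_succ_iff.1 hi))]
      rcases eq_or_ne i a with rfl | hia
      · exact Function.update_self _ _ _
      · rw [hne i hia]
        refine hx i (lt_of_le_of_ne (Nat.lt_succ_iff.1 hi) fun h => hia (Fin.ext h))
  obtain ⟨x, hx⟩ := step n le_rfl
  refine ⟨x, mem_innerSol_iff_forall.2 fun i => ?_⟩
  have := hJ i (kron S z i + kron N x i)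
  rwa [← hx i i.2] at this

/-- Solutions of the inner problem depend on `z` in a Lipschitz continuous way, by forward
substitution in the strictly lower triangular `N`. -/
theorem exists_norm_sub_le_of_mem_innerSol (hF : ∀ i, IsMonotone (F i))
    (hN : ∀ i j, i ≤ j → N i j = 0) :
    ∃ C : ℝ, ∀ (z z' : HPow H m) (x x' : HPow H n), x ∈ innerSol F S N z → x' ∈ innerSol F S N z' →
      ‖x - x'‖ ≤ C * ‖z - z'‖ := by
  have hcomp : ∀ i : Fin n, ∃ C : ℝ, ∀ (z z' : HPow H m) (x x' : HPow H n),
      x ∈ innerSol F S N z → x' ∈ innerSol F S N z' → ‖x i - x' i‖ ≤ C * ‖z - z'‖ := by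
    intro i
    induction i using WellFoundedLT.induction with
    | ind i ih =>
    choose! C hC using ih
    refine ⟨∑ j, |S i j| + ∑ j, |N i j| * C j, fun z z' x x' hx hx' => ?_⟩
    refine ((hF i).norm_sub_le_of_mem_resolvent (mem_innerSol_iff_forall.1 hx i)
      (mem_innerSol_iff_forall.1 hx' i)).trans ?_
    have e : kron S z i + kron N x i - (kron S z' i + kron N x' i) =
        ∑ j, S i j • (z - z') j + ∑ j, N i j • (x j - x' j) := by
      simp only [kron_apply, PiLp.sub_apply, smul_sub, Finset.sum_sub_distrib]
      abel
    rw [e, add_mul, Finset.sum_mul, Finset.sum_mul]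
    refine (norm_add_le _ _).trans (add_le_add ?_ ?_)
    · refine (norm_sum_le _ _).trans (Finset.sum_le_sum fun j _ => ?_)
      rw [norm_smul, Real.norm_eq_abs]
      exact mul_le_mul_of_nonneg_left (PiLp.norm_apply_le _ j) (abs_nonneg _)
    · refine (norm_sum_le _ _).trans (Finset.sum_le_sum fun j _ => ?_)
      rw [norm_smul, Real.norm_eq_abs, mul_assoc]
      rcases le_or_gt i j with hij | hij
      · simp [hN i j hij]
      · exact mul_le_mul_of_nonneg_left (hC j hij z z' x x' hx hx') (abs_nonneg _)
  choose C hC using hcomp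
  refine ⟨Real.sqrt (∑ i, C i ^ 2), fun z z' x x' hx hx' => ?_⟩
  refine le_of_sq_le_sq ?_ (by positivity)
  rw [mul_pow, Real.sq_sqrt (by positivity), PiLp.norm_sq_eq_of_L2, Finset.sum_mul]
  refine Finset.sum_le_sum fun i _ => ?_
  rw [← mul_pow]
  exact pow_le_pow_left₀ (norm_nonneg _) (hC i z z' x x' hx hx') 2

theorem eq_of_mem_innerSol (hF : ∀ i, IsMonotone (F i)) (hN : ∀ i j, i ≤ j → N i j = 0)
    {z : HPow H m} {x x' : HPow H n} (hx : x ∈ innerSol F S N z) (hx' : x' ∈ innerSol F S N z) :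
    x = x' := by
  obtain ⟨C, hC⟩ := exists_norm_sub_le_of_mem_innerSol (m := m) (S := S) hF hN
  have := hC z z x x' hx hx'
  rwa [sub_self, norm_zero, mul_zero, norm_le_zero_iff, sub_eq_zero] at this

end Inner

/-! ### Fixed points and Fejér monotonicity -/

section FixedPoints

variable {H : Type*} [NormedAddCommGroup H] [InnerProductSpace ℝ H] {m n : ℕ}
  {F : Fin n → H → Set H} {M : Matrix (Fin m) (Fin n) ℝ} {S : Matrix (Fin n) (Fin m) ℝ}
  {N : Matrix (Fin n) (Fin n) ℝ}

/-- A zero `c` of `∑ i, F i` gives a fixed point of the splitting operator: with `x = (c, …, c)` and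
`u i ∈ F i c` summing to zero, `x + u - N x` sums to zero since the entries of `N` sum to `n`, and
so lies in the range of `S`. -/
theorem exists_mem_innerSol_kron_eq_zero (h : CoeffAssumption M S N)
    (hzer : (zer (opSum F)).Nonempty) :
    ∃ (z : HPow H m) (x : HPow H n), x ∈ innerSol F S N z ∧ kron M x = 0 := by
  obtain ⟨c, u, hu, hsum⟩ := hzer
  set x : HPow H n := WithLp.toLp 2 fun _ => c with hx
  have hr : ∑ i, (x + WithLp.toLp 2 u - kron N x) i = 0 := by
    simp only [PiLp.sub_apply, PiLp.add_apply, Finset.sum_sub_distrib, Finset.sum_add_distrib]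
    rw [hx, h.sum_kron_const, ← hsum]
    simp [Nat.cast_smul_eq_nsmul]
  obtain ⟨z, hz⟩ := h.exists_kron_eq_of_sum_eq_zero hr
  refine ⟨z, x, mem_innerSol_iff.2 ?_, h.kron_const c⟩
  rw [hz, show x + WithLp.toLp 2 u - kron N x + kron N x - x = WithLp.toLp 2 u by abel]
  exact hu

/-- A fixed point of the splitting operator gives a zero of `∑ i, F i`. -/
theorem exists_mem_zer_of_kron_eq_zero (h : CoeffAssumption M S N) {z : HPow H m} {x : HPow H n}
    (hx : x ∈ innerSol F S N z) (hMx : kron M x = 0) :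
    ∃ c ∈ zer (opSum F), x = WithLp.toLp 2 fun _ => c := by
  obtain ⟨c, rfl⟩ := h.exists_eq_const_of_kron_eq_zero hMx
  refine ⟨c, ⟨_, mem_innerSol_iff.1 hx, ?_⟩, rfl⟩
  simp only [PiLp.sub_apply, PiLp.add_apply, Finset.sum_sub_distrib, Finset.sum_add_distrib]
  rw [h.sum_kron_eq_zero, h.sum_kron_const]
  simp [Nat.cast_smul_eq_nsmul]

/-- Monotonicity of the `F i`, rewritten by means of `S = -Mᵀ` and the semidefiniteness assumption:
`z ↦ -M x` is cocoercive. -/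
theorem two_mul_inner_le_of_mem_innerSol (h : CoeffAssumption M S N) (hF : ∀ i, IsMonotone (F i))
    {z z' : HPow H m} {x x' : HPow H n} (hx : x ∈ innerSol F S N z)
    (hx' : x' ∈ innerSol F S N z') :
    2 * inner ℝ (z - z') (kron M (x - x')) ≤ -‖kron M (x - x')‖ ^ 2 := by
  have h1 := inner_opProd_nonneg hF (mem_innerSol_iff.1 hx) (mem_innerSol_iff.1 hx')
  have h2 := h.norm_sq_kron_le (x - x')
  rw [show kron S z + kron N x - x - (kron S z' + kron N x' - x') =
      kron S (z - z') + kron N (x - x') - (x - x') by rw [kron_sub, kron_sub]; abel,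
    inner_sub_right, inner_add_right, real_inner_self_eq_norm_sq, h.inner_kron_eq_neg,
    real_inner_comm] at h1
  linarith

/-- Fejér monotonicity with respect to the fixed points of the splitting operator, with the
quantitative decrease of an averaged operator. -/
theorem norm_sq_add_smul_sub_le (h : CoeffAssumption M S N) (hF : ∀ i, IsMonotone (F i))
    {γ : ℝ} (hγ : 0 ≤ γ) {z z' : HPow H m} {x x' : HPow H n} (hx : x ∈ innerSol F S N z)
    (hx' : x' ∈ innerSol F S N z') (hMx' : kron M x' = 0) :
    ‖z + γ • kron M x - z'‖ ^ 2 ≤ ‖z - z'‖ ^ 2 - γ * (1 - γ) * ‖kron M x‖ ^ 2 := by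
  have h1 := two_mul_inner_le_of_mem_innerSol h hF hx hx'
  rw [kron_sub, hMx', sub_zero] at h1
  rw [show z + γ • kron M x - z' = (z - z') + γ • kron M x by abel, norm_add_sq_real, norm_smul,
    real_inner_smul_right, Real.norm_of_nonneg hγ]
  nlinarith [mul_le_mul_of_nonneg_left h1 hγ]

/-- Demiclosedness: if `z k` and `x k` converge weakly, `x k` solves the inner problem for `z k`,
and `M (x k)` tends to zero strongly, then the limits form a fixed point. With
`u k = S (z k) + N (x k) - x k`, the products `⟪x k, u k⟫`, which weak convergence does not control,
are at most `-⟪M (x k), z k⟫ → 0`, while `⟪x', u'⟫ = 0` for the limits because `x'` is diagonal.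
Hence `(x', u')` is monotonically related to the graph of the product of the `F i`. -/
theorem mem_innerSol_of_tendsto_inner [CompleteSpace H] (h : CoeffAssumption M S N)
    (hF : ∀ i, IsMaximallyMonotone (F i)) {ι : Type*} {l : Filter ι} [l.NeBot]
    {z : ι → HPow H m} {x : ι → HPow H n} (hx : ∀ k, x k ∈ innerSol F S N (z k)) {R : ℝ}
    (hz : ∀ k, ‖z k‖ ≤ R) (hM : Tendsto (fun k => kron M (x k)) l (𝓝 0))
    {z' : HPow H m} {x' : HPow H n}
    (hz' : ∀ w, Tendsto (fun k => inner ℝ w (z k)) l (𝓝 (inner ℝ w z')))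
    (hx' : ∀ w, Tendsto (fun k => inner ℝ w (x k)) l (𝓝 (inner ℝ w x'))) :
    x' ∈ innerSol F S N z' ∧ kron M x' = 0 := by
  have hMx' : kron M x' = 0 := by
    refine ext_inner_left ℝ fun w => ?_
    have h1 : Tendsto (fun k => inner ℝ w (kron M (x k))) l (𝓝 (inner ℝ w (kron M x'))) := by
      simpa only [inner_kron_right] using hx' (kron M.transpose w)
    exact tendsto_nhds_unique h1 (tendsto_const_nhds.inner hM)
  refine ⟨mem_innerSol_iff.2 (mem_opProd_of_forall_inner_nonneg hF fun a b hab => ?_), hMx'⟩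
  have hzero : inner ℝ x' (kron S z' + kron N x' - x') = 0 := by
    rw [inner_sub_right, inner_add_right, h.inner_kron_eq_neg, hMx']
    obtain ⟨c, rfl⟩ := h.exists_eq_const_of_kron_eq_zero hMx'
    rw [inner_toLp_const_left, inner_toLp_const_left, h.sum_kron_const]
    simp [Nat.cast_smul_eq_nsmul]
  have hskew : Tendsto (fun k => inner ℝ (kron M (x k)) (z k)) l (𝓝 0) := by
    refine squeeze_zero_norm (a := fun k => ‖kron M (x k)‖ * R) (fun k => ?_) ?_
    · exact (norm_inner_le_norm _ _).trans (mul_le_mul_of_nonneg_left (hz k) (norm_nonneg _))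
    · simpa using hM.norm.mul_const R
  have hw : Tendsto (fun k => inner ℝ a (kron S (z k) + kron N (x k) - x k)) l
      (𝓝 (inner ℝ a (kron S z' + kron N x' - x'))) := by
    simp only [inner_sub_right, inner_add_right, inner_kron_right S, inner_kron_right N]
    exact ((hz' _).add (hx' _)).sub (hx' _)
  have hlim := ((hskew.neg.sub (hx' b)).sub hw).add_const (inner ℝ a b)
  have h0 := ge_of_tendsto' hlim fun k => show (0 : ℝ) ≤ _ by
    have h1 := inner_opProd_nonneg (fun i => (hF i).1) (mem_innerSol_iff.1 (hx k)) hab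
    have h2 := h.norm_sq_kron_le (x k)
    have h3 : inner ℝ (x k) (kron S (z k) + kron N (x k) - x k) =
        -inner ℝ (kron M (x k)) (z k) + inner ℝ (x k) (kron N (x k)) - ‖x k‖ ^ 2 := by
      rw [inner_sub_right, inner_add_right, h.inner_kron_eq_neg, real_inner_self_eq_norm_sq]
    rw [inner_sub_left, inner_sub_right, inner_sub_right (x := a), h3, real_inner_comm b] at h1
    nlinarith [sq_nonneg ‖kron M (x k)‖]
  rw [inner_sub_left, inner_sub_right, inner_sub_right (x := a), hzero, real_inner_comm b]
  linarith

end FixedPoints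

end ResolventSplitting

theorem mainTheorem1 {H : Type*} [NormedAddCommGroup H] [InnerProductSpace ℝ H] [CompleteSpace H]
    {m n : ℕ} (F : Fin n → H → Set H) (hF : ∀ i, IsMaximallyMonotone (F i))
    (hzer : (zer (opSum F)).Nonempty)
    (M : Matrix (Fin m) (Fin n) ℝ) (S : Matrix (Fin n) (Fin m) ℝ) (N : Matrix (Fin n) (Fin n) ℝ)
    (hMSN : CoeffAssumption M S N) (γ : ℝ) (hγ : γ ∈ Set.Ioo (0 : ℝ) 1) :
    (∀ z : HPow H m, ∃! x : HPow H n, x ∈ innerSol F S N z) ∧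
    ∀ (z : ℕ → HPow H m) (x : ℕ → HPow H n),
      (∀ k, x k ∈ innerSol F S N (z k)) →
      (∀ k, z (k + 1) = z k + γ • kron M (x k)) →
      (Tendsto (fun k => z k - z (k + 1)) atTop (𝓝 0) ∧
        ∀ s : Fin n → ℝ, ∑ i, s i = 0 → Tendsto (fun k => ∑ i, s i • x k i) atTop (𝓝 0)) ∧
      (∃ zbar ∈ Fix (splitOp F M S N γ), WeakTendsto z zbar) ∧
      (∃ xbar ∈ zer (opSum F), WeakTendsto x (WithLp.toLp 2 (fun _ => xbar))) := by
  have hmon : ∀ i, IsMonotone (F i) := fun i => (hF i).1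
  refine ⟨fun z => ?_, fun z x hx hz => ?_⟩
  · obtain ⟨x, hx⟩ := exists_mem_innerSol (S := S) hF hMSN.strictLower z
    exact ⟨x, hx, fun x' hx' => eq_of_mem_innerSol hmon hMSN.strictLower hx' hx⟩
  have hstep : ∀ (z' : HPow H m) (x' : HPow H n), x' ∈ innerSol F S N z' → kron M x' = 0 → ∀ k,
      ‖z (k + 1) - z'‖ ^ 2 ≤ ‖z k - z'‖ ^ 2 - γ * (1 - γ) * ‖kron M (x k)‖ ^ 2 := by
    intro z' x' hx' hMx' k
    rw [hz k]
    exact norm_sq_add_smul_sub_le hMSN hmon hγ.1.le (hx k) hx' hMx'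
  have hγ' : 0 < γ * (1 - γ) := mul_pos hγ.1 (sub_pos.2 hγ.2)
  have hanti : ∀ (z' : HPow H m) (x' : HPow H n), x' ∈ innerSol F S N z' → kron M x' = 0 →
      Antitone fun k => ‖z k - z'‖ ^ 2 := fun z' x' hx' hMx' =>
    antitone_nat_of_succ_le fun k => (hstep z' x' hx' hMx' k).trans
      (sub_le_self _ (mul_nonneg hγ'.le (sq_nonneg _)))
  have hconv : ∀ (z' : HPow H m) (x' : HPow H n), x' ∈ innerSol F S N z' → kron M x' = 0 →
      ∃ L, Tendsto (fun k => ‖z k - z'‖ ^ 2) atTop (𝓝 L) := fun z' x' hx' hMx' =>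
    ⟨_, tendsto_atTop_ciInf (hanti z' x' hx' hMx') ⟨0, by rintro _ ⟨k, rfl⟩; positivity⟩⟩
  obtain ⟨z₀, x₀, hx₀, hMx₀⟩ := exists_mem_innerSol_kron_eq_zero hMSN hzer
  have hM : Tendsto (fun k => kron M (x k)) atTop (𝓝 0) := by
    obtain ⟨L, hL⟩ := hconv z₀ x₀ hx₀ hMx₀
    have h1 : Tendsto (fun k => ‖kron M (x k)‖ ^ 2) atTop (𝓝 0) := by
      refine squeeze_zero (g := fun k => (γ * (1 - γ))⁻¹ * (‖z k - z₀‖ ^ 2 - ‖z (k + 1) - z₀‖ ^ 2))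
        (fun k => sq_nonneg _) (fun k => ?_) ?_
      · rw [← div_eq_inv_mul, le_div_iff₀ hγ']
        linarith [hstep z₀ x₀ hx₀ hMx₀ k]
      · simpa using (hL.sub (hL.comp (tendsto_add_atTop_nat 1))).const_mul (γ * (1 - γ))⁻¹
    refine tendsto_zero_iff_norm_tendsto_zero.2 ?_
    simpa only [Function.comp_def, Real.sqrt_sq (norm_nonneg _), Real.sqrt_zero] using
      (Real.continuous_sqrt.tendsto _).comp h1
  have hzb : ∀ k, ‖z k‖ ≤ ‖z 0 - z₀‖ + ‖z₀‖ := fun k => by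
    have h1 := le_of_sq_le_sq (hanti z₀ x₀ hx₀ hMx₀ (Nat.zero_le k)) (norm_nonneg _)
    have h2 := norm_add_le (z k - z₀) z₀
    rw [sub_add_cancel] at h2
    linarith
  obtain ⟨R, hxb⟩ : ∃ R, ∀ k, ‖x k‖ ≤ R := by
    obtain ⟨C, hC⟩ := exists_norm_sub_le_of_mem_innerSol (m := m) (S := S) hmon hMSN.strictLower
    refine ⟨|C| * ‖z 0 - z₀‖ + ‖x₀‖, fun k => ?_⟩
    have h1 := le_of_sq_le_sq (hanti z₀ x₀ hx₀ hMx₀ (Nat.zero_le k)) (norm_nonneg _)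
    have h2 := norm_add_le (x k - x₀) x₀
    rw [sub_add_cancel] at h2
    have h3 := (hC _ _ _ _ (hx k) hx₀).trans
      (mul_le_mul (le_abs_self C) h1 (norm_nonneg _) (abs_nonneg C))
    linarith
  -- Weak limits along ultrafilters exist, are fixed points, and, by Opial's argument, do not
  -- depend on the ultrafilter.
  have hlim : ∀ U : Ultrafilter ℕ, (U : Filter ℕ) ≤ atTop → ∃ (z' : HPow H m) (x' : HPow H n),
      (∀ w, Tendsto (fun k => inner ℝ w (z k)) U (𝓝 (inner ℝ w z'))) ∧
      (∀ w, Tendsto (fun k => inner ℝ w (x k)) U (𝓝 (inner ℝ w x'))) ∧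
      x' ∈ innerSol F S N z' ∧ kron M x' = 0 := by
    intro U hU
    obtain ⟨z', hz'⟩ := exists_forall_tendsto_inner_of_norm_le U hzb
    obtain ⟨x', hx'⟩ := exists_forall_tendsto_inner_of_norm_le U hxb
    exact ⟨z', x', hz', hx',
      mem_innerSol_of_tendsto_inner hMSN hF hx hzb (hM.mono_left hU) hz' hx'⟩
  obtain ⟨z₁, x₁, hz₁, -, hsol₁, hMx₁⟩ := hlim (Ultrafilter.of atTop) (Ultrafilter.of_le _)
  have hall : ∀ U : Ultrafilter ℕ, (U : Filter ℕ) ≤ atTop →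
      (∀ w, Tendsto (fun k => inner ℝ w (z k)) U (𝓝 (inner ℝ w z₁))) ∧
      (∀ w, Tendsto (fun k => inner ℝ w (x k)) U (𝓝 (inner ℝ w x₁))) := by
    intro U hU
    obtain ⟨z₂, x₂, hz₂, hx₂, hsol₂, hMx₂⟩ := hlim U hU
    obtain ⟨L₁, hL₁⟩ := hconv z₁ x₁ hsol₁ hMx₁
    obtain ⟨L₂, hL₂⟩ := hconv z₂ x₂ hsol₂ hMx₂
    -- Both distances converge along the whole sequence, hence so does their difference, which is
    -- affine in `z k`.
    have hin : Tendsto (fun k => inner ℝ (z₁ - z₂) (z k)) atTop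
        (𝓝 ((L₂ - L₁ + (‖z₁‖ ^ 2 - ‖z₂‖ ^ 2)) / 2)) := by
      refine (((hL₂.sub hL₁).add_const _).div_const 2).congr fun k => ?_
      rw [norm_sub_sq_real, norm_sub_sq_real, inner_sub_left, real_inner_comm (z k) z₁,
        real_inner_comm (z k) z₂]
      ring
    have e₁ := tendsto_nhds_unique (hz₁ (z₁ - z₂)) (hin.mono_left (Ultrafilter.of_le _))
    have e₂ := tendsto_nhds_unique (hz₂ (z₁ - z₂)) (hin.mono_left hU)
    have e : z₁ = z₂ := by
      rw [← sub_eq_zero, ← inner_self_eq_zero (𝕜 := ℝ), inner_sub_right, e₁, e₂, sub_self]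
    subst e
    obtain rfl := eq_of_mem_innerSol hmon hMSN.strictLower hsol₁ hsol₂
    exact ⟨hz₂, hx₂⟩
  refine ⟨⟨?_, fun s hs => ?_⟩, ⟨z₁, ⟨x₁, hsol₁, by simp [hMx₁]⟩, ?_⟩, ?_⟩
  · refine (by simpa using (hM.const_smul γ).neg : Tendsto (fun k => -(γ • kron M (x k))) atTop
      (𝓝 0)).congr fun k => ?_
    rw [hz k]; abel
  · obtain ⟨W, hW⟩ := hMSN.exists_kron_kron_eq_sub_mean (H := H)
    have e : ∀ k, ∑ i, s i • x k i = ∑ i, s i • ∑ j, W i j • kron M (x k) j := by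
      intro k
      simp only [← kron_apply W, hW, smul_sub, Finset.sum_sub_distrib, ← Finset.sum_smul, hs,
        zero_smul, sub_zero]
    simp only [e]
    have hMj : ∀ j, Tendsto (fun k => kron M (x k) j) atTop (𝓝 0) := fun j =>
      ((PiLp.continuous_apply 2 _ j).tendsto _).comp hM
    have := tendsto_finsetSum Finset.univ fun i (_ : i ∈ Finset.univ) =>
      (tendsto_finsetSum Finset.univ fun j (_ : j ∈ Finset.univ) =>
        (hMj j).const_smul (W i j)).const_smul (s i)
    simpa using this
  · exact weakTendsto_iff_forall_inner.2 fun w =>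
      (tendsto_iff_ultrafilter _ _ _).2 fun U hU => (hall U hU).1 w
  · obtain ⟨c, hc, rfl⟩ := exists_mem_zer_of_kron_eq_zero hMSN hsol₁ hMx₁
    exact ⟨c, hc, weakTendsto_iff_forall_inner.2 fun w =>
      (tendsto_iff_ultrafilter _ _ _).2 fun U hU => (hall U hU).2 w⟩
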